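/- Let $p,q,r$ be positive integers or $\infty$, with the convention $1/\infty=0$. Let $$\Delta[p,q,r]=\langle R_0,R_1,R_2\mid R_i^2=(R_1R_2)^p=(R_2R_0)^q=(R_0R_1)^r=1\rangle$$ be the extended triangle group, where relations of the form $W^\infty=1$ are omitted. A hypermap of type $(p,q,r)$ (possibly non-orientable or with boundary) is given by a set $\Omega$ of flags together with permutations $R_0,R_1,R_2$ of $\Omega$ satisfying the above relations, that is, by a permutation representation of $\Delta[p,q,r]$ on $\Omega$. Morphisms are the maps of flags commuting with $R_0,R_1,R_2$, so that the automorphism group of a hypermap is the group of all permutations of $\Omega$ commuting with the action of $\Delta[p,q,r]$; the hypermap is connected if $\Omega\neq\emptyset$ and the action is transitive. Suppose that $(p,q,r)$ is hyperbolic, that is, $\frac1p+\frac1q+\frac1r<1$, and that at least one of $p,q,r$ is $\infty$. Then the extended triangle group $\Delta[p,q,r]$ and the category of all hypermaps of type $(p,q,r)$ have the countable automorphism realisation property. That is, for every countable (finite or countably infinite) group $A$: 1. there is a subgroup $M$ of $\Gamma=\Delta[p,q,r]$ with $N_\Gamma(M)/M\cong A$, where $N_\Gamma(M)$ is the normaliser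 of $M$ in $\Gamma$; 2. there is a connected hypermap of type $(p,q,r)$ whose automorphism group is isomorphic to $A$. -/

import Mathlib

open CategoryTheory
open scoped ENNReal

universe u v w

/-! ### Triples of periods and extended triangle groups

Periods are elements of `ℕ∞`, with `⊤` playing the role of the infinite period. -/

/-- `(p, q, r)` is a hyperbolic triple: `1/p + 1/q + 1/r < 1`, where `1/∞ = 0`.
In `ℝ≥0∞` one has `1/0 = ∞`, so all entries of a hyperbolic triple are positive. -/
def IsHyperbolicTriple (p q r : ℕ∞) : Prop :=
  (p : ℝ≥0∞)⁻¹ + (q : ℝ≥0∞)⁻¹ + (r : ℝ≥0∞)⁻¹ < 1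

/-- The relation `w ^ p = 1` in a group, no condition being imposed when `p = ∞`. -/
def PowEqOne {G : Type*} [Group G] (w : G) (p : ℕ∞) : Prop :=
  ∀ n : ℕ, p = (n : ℕ∞) → w ^ n = 1

/-- The relators `R_i ^ 2`, `(R₁ R₂) ^ p`, `(R₂ R₀) ^ q`, `(R₀ R₁) ^ r` of the extended
triangle group; a relator with infinite exponent is omitted. -/
def extendedTriangleRels (p q r : ℕ∞) : Set (FreeGroup (Fin 3)) :=
  {w | (∃ i : Fin 3, w = FreeGroup.of i ^ 2) ∨
    (∃ n : ℕ, p = (n : ℕ∞) ∧ w = (FreeGroup.of 1 * FreeGroup.of 2) ^ n) ∨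
    (∃ n : ℕ, q = (n : ℕ∞) ∧ w = (FreeGroup.of 2 * FreeGroup.of 0) ^ n) ∨
    (∃ n : ℕ, r = (n : ℕ∞) ∧ w = (FreeGroup.of 0 * FreeGroup.of 1) ^ n)}

/-- The extended triangle group
`Δ[p,q,r] = ⟨R₀, R₁, R₂ ∣ R_i² = (R₁R₂)^p = (R₂R₀)^q = (R₀R₁)^r = 1⟩`. -/
abbrev ExtendedTriangleGroup (p q r : ℕ∞) : Type :=
  PresentedGroup (extendedTriangleRels p q r)

/-! ### The category of hypermaps of a given type -/

/-- A hypermap of type `(p, q, r)`, possibly non-orientable, with boundary, or disconnected,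
given by its set of flags and the three permutations `R_i` changing the `i`-dimensional component
of a flag whenever possible (a fixed flag of `R_i` lies on the boundary). The valencies of
the hypervertices, hyperedges and hyperfaces divide `p`, `q`, `r`, where every positive integer
divides `∞`. -/
structure Hypermap (p q r : ℕ∞) where
  Flag : Type v
  R : Fin 3 → Equiv.Perm Flag
  sq_eq_one : ∀ i, R i ^ 2 = 1
  pow_p : PowEqOne (R 1 * R 2) p
  pow_q : PowEqOne (R 2 * R 0) q
  pow_r : PowEqOne (R 0 * R 1) r

namespace Hypermap

variable {p q r : ℕ∞}

/-- Morphisms of hypermaps are the maps of flags commuting with `R₀`, `R₁`, `R₂`. -/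
@[ext]
structure Hom (H K : Hypermap.{v} p q r) where
  toFun : H.Flag → K.Flag
  map_R : ∀ i x, toFun (H.R i x) = K.R i (toFun x)

/-- The category of all hypermaps of type `(p, q, r)`. -/
instance : Category (Hypermap.{v} p q r) where
  Hom := Hom
  id H := ⟨id, fun _ _ => rfl⟩
  comp f g := ⟨g.toFun ∘ f.toFun, fun i x => by simp [f.map_R, g.map_R]⟩

/-- The permutation representation of the parent group `Δ[p,q,r]` on the flags of a hypermap. -/
def rep (H : Hypermap.{v} p q r) : ExtendedTriangleGroup p q r →* Equiv.Perm H.Flag :=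
  PresentedGroup.toGroup (f := H.R) (by
    rintro w (⟨i, rfl⟩ | ⟨n, hn, rfl⟩ | ⟨n, hn, rfl⟩ | ⟨n, hn, rfl⟩)
    · simpa using H.sq_eq_one i
    · simpa using H.pow_p n hn
    · simpa using H.pow_q n hn
    · simpa using H.pow_r n hn)

/-- The monodromy group of a hypermap. -/
def monodromyGroup (H : Hypermap.{v} p q r) : Subgroup (Equiv.Perm H.Flag) :=
  H.rep.range

/-- A hypermap is connected if it is non-empty and its monodromy group is transitive on flags. -/
def IsConnected (H : Hypermap.{v} p q r) : Prop :=
  Nonempty H.Flag ∧ ∀ x y : H.Flag, ∃ g ∈ H.monodromyGroup, g x = y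

lemma map_rep (H : Hypermap.{v} p q r) (c : Equiv.Perm H.Flag)
    (hc : ∀ i, H.R i * c = c * H.R i) (g : ExtendedTriangleGroup p q r) :
    H.rep g * c = c * H.rep g := by
  induction g using PresentedGroup.induction_on with
  | _ w =>
    change Commute (FreeGroup.lift H.R w) c
    induction w using FreeGroup.induction_on with
    | C1 => simp
    | of i => rw [FreeGroup.lift_apply_of]; exact hc i
    | inv_of i h => simpa using h
    | mul a b ha hb => rw [map_mul]; exact ha.mul_left hb

/-- The automorphism group of a hypermap in the category of hypermaps is the group of
permutations of its flags commuting with the monodromy group. -/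
def autEquivCentralizer (H : Hypermap.{v} p q r) :
    Aut H ≃* Subgroup.centralizer (H.monodromyGroup : Set (Equiv.Perm H.Flag)) where
  toFun f := ⟨⟨f.hom.toFun, f.inv.toFun,
      fun x => congrFun (congrArg Hom.toFun f.hom_inv_id) x,
      fun x => congrFun (congrArg Hom.toFun f.inv_hom_id) x⟩, by
    rintro _ ⟨g, rfl⟩
    refine map_rep H _ (fun i => ?_) g
    ext x
    exact (f.hom.map_R i x).symm⟩
  invFun c :=
    have hc : ∀ i, H.R i * c.1 = c.1 * H.R i := fun i =>
      c.2 (H.R i) ⟨PresentedGroup.of i, PresentedGroup.toGroup.of _⟩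
    { hom := ⟨c.1, fun i x => (Equiv.congr_fun (hc i) x).symm⟩
      inv := ⟨c.1.symm, fun i x => by
        rw [Equiv.symm_apply_eq]
        simpa using Equiv.congr_fun (hc i) (c.1.symm x)⟩
      hom_inv_id := Hom.ext (funext fun x => c.1.symm_apply_apply x)
      inv_hom_id := Hom.ext (funext fun x => c.1.apply_symm_apply x) }
  left_inv _ := rfl
  right_inv _ := rfl
  map_mul' _ _ := rfl

end Hypermap

/-! ### The countable automorphism realisation property

Here `Countable` includes the finite groups. -/

/-- A group `Γ` has the countable automorphism realisation property if every countable group `A`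
is isomorphic to `N_Γ(M)/M` for some subgroup `M` of `Γ`. -/
def GroupHasCARP (Γ : Type w) [Group Γ] : Prop :=
  ∀ (A : Type u) [Group A] [Countable A], ∃ M : Subgroup Γ,
    Nonempty (A ≃* Subgroup.normalizer (M : Set Γ) ⧸ M.subgroupOf (Subgroup.normalizer (M : Set Γ)))

/-- The category of hypermaps of type `(p, q, r)` has the countable automorphism realisation
property if every countable group is isomorphic to the automorphism group of some connected
hypermap of type `(p, q, r)`. -/
def HypermapsHaveCARP (p q r : ℕ∞) : Prop :=
  ∀ (A : Type u) [Group A] [Countable A], ∃ H : Hypermap.{v} p q r,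
    H.IsConnected ∧ Nonempty (A ≃* Aut H)

/-!
An infinite period drops one relation of the extended triangle group, so that `Γ = Δ[p,q,r]` acts
on a set through any three involutions `a`, `b`, `c` such that the periods of `a c` and `b c` divide
the two remaining entries `x`, `y`. As `1/x + 1/y < 1`, finite periods `s ≥ 3` and `t ≥ 2` are
available (`exists_periods`).

For a countable group `A`, such an action is built on the double `E × Bool` of a set `E` with
permutations `σ`, `τ` of orders dividing `s` and `t`; the double corresponds to an orientable
hypermap with its two orientations. Here `E` is the `A`-covering given by a voltage assignment on an
infinite bipartite graph. The vertices `0, 1, 2, …` have `s` ports each, turned by `σ`, and cells of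
`t` positions are turned by `τ`, a cell containing at most two ports; the empty cells play no role.
The vertices `1, 2, 3, …` are joined in a path, and all remaining ports of `2m` are joined to those
of `2m + 1`, with voltage `a m`, except for three leaf ports: ports `0` and `1` of vertex `0`, and
port `0` of vertex `1`.
Left multiplication makes `A` act by automorphisms.

* Since the voltages exhaust `A`, the fibre over port `0` of vertex `0` is contained in one orbit
  (`VoltageGraph.rel_port_of_surjective`).
* The positions of the leaves characterise that fibre in terms of which words in the generators fix
  a flag (`VoltageGraph.isMarked_true_iff`), and since their arrangement is chiral no flag on the
  opposite sheet has the same property (`VoltageGraph.not_isMarked_false`).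

Hence the flags in the orbit of the base flag `ω` that have the same stabiliser `M` as `ω` are
exactly the translates of `ω` under `A`, on which `A` is simply transitive, and this says that
`N(M)/M ≅ A` (`exists_subgroup_mulEquiv_normalizer_quotient`). The action on the cosets of `M` is a
connected hypermap with automorphism group `N(M)/M` (`Hypermap.exists_isConnected_aut_mulEquiv`).
-/

/-! ### Normaliser quotients and automorphism groups of transitive actions -/

section Normalizer

variable {Γ Ω A : Type*} [Group Γ] [Group A]

/-- Let `A` act on a `Γ`-set by automorphisms, simply transitively on the points of the `Γ`-orbit
of `ω` that have the same stabiliser as `ω`. Then `A` is the normaliser quotient of that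
stabiliser. -/
theorem exists_subgroup_mulEquiv_normalizer_quotient (ρ : Γ →* Equiv.Perm Ω)
    (α : A →* Equiv.Perm Ω) (ω : Ω) (hcomm : ∀ γ x, Commute (ρ γ) (α x))
    (hfree : ∀ x, α x ω = ω → x = 1) (horbit : ∀ x, ∃ γ, ρ γ ω = α x ω)
    (hstab : ∀ γ, (∀ δ, ρ δ (ρ γ ω) = ρ γ ω ↔ ρ δ ω = ω) → ∃ x, ρ γ ω = α x ω) :
    ∃ M : Subgroup Γ, Nonempty (A ≃* Subgroup.normalizer (M : Set Γ) ⧸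
      M.subgroupOf (Subgroup.normalizer (M : Set Γ))) := by
  have hcomm' (γ : Γ) (x : A) (y : Ω) : ρ γ (α x y) = α x (ρ γ y) :=
    Equiv.congr_fun (hcomm γ x) y
  let M : Subgroup Γ :=
    { carrier := {γ | ρ γ ω = ω}
      one_mem' := by simp
      mul_mem' := fun {a b} ha hb => by
        simp only [Set.mem_ofPred_eq] at *
        rw [map_mul, Equiv.Perm.mul_apply, hb, ha]
      inv_mem' := fun {a} ha => by
        simp only [Set.mem_ofPred_eq] at *
        rw [map_inv, Equiv.Perm.inv_eq_iff_eq, ha] }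
  have hM (γ : Γ) : γ ∈ M ↔ ρ γ ω = ω := Iff.rfl
  have hnorm (γ : Γ) : γ ∈ Subgroup.normalizer (M : Set Γ) ↔ ∃ x, ρ γ ω = α x ω := by
    rw [Subgroup.mem_normalizer_iff'']
    have key (δ : Γ) : γ⁻¹ * δ * γ ∈ M ↔ ρ δ (ρ γ ω) = ρ γ ω := by
      rw [hM]
      simp only [map_mul, map_inv, Equiv.Perm.mul_apply]
      rw [Equiv.Perm.inv_eq_iff_eq]
    simp only [key, hM]
    refine ⟨fun h => hstab γ fun δ => (h δ).symm, ?_⟩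
    rintro ⟨x, hx⟩ δ
    rw [hx, hcomm', (α x).injective.eq_iff]
  have hinj (x y : A) (h : α x ω = α y ω) : x = y := by
    have : α (y⁻¹ * x) ω = ω := by
      rw [map_mul, Equiv.Perm.mul_apply, h, ← Equiv.Perm.mul_apply, ← map_mul]
      simp
    exact (inv_mul_eq_one.mp (hfree _ this)).symm
  choose f hf using fun n : Subgroup.normalizer (M : Set Γ) => (hnorm n).1 n.2
  -- Since `γ ↦ f γ` reverses products, the homomorphism is `γ ↦ (f γ)⁻¹`.
  let φ : Subgroup.normalizer (M : Set Γ) →* A := MonoidHom.mk' (fun n => (f n)⁻¹) (by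
    intro m n
    rw [← mul_inv_rev, inv_inj]
    refine hinj _ _ ?_
    rw [← hf, map_mul α, Equiv.Perm.mul_apply, ← hf m, ← hcomm', ← hf n, Subgroup.coe_mul,
      map_mul, Equiv.Perm.mul_apply])
  have hφ : Function.Surjective φ := by
    intro x
    obtain ⟨γ, hγ⟩ := horbit x⁻¹
    refine ⟨⟨γ, (hnorm γ).2 ⟨_, hγ⟩⟩, ?_⟩
    change (f _)⁻¹ = x
    rw [inv_eq_iff_eq_inv]
    exact hinj _ _ ((hf _).symm.trans hγ)
  have hker : φ.ker = M.subgroupOf (Subgroup.normalizer (M : Set Γ)) := by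
    ext n
    rw [MonoidHom.mem_ker, Subgroup.mem_subgroupOf, hM, hf n]
    change (f n)⁻¹ = 1 ↔ _
    rw [inv_eq_one]
    exact ⟨fun h => by simp [h], hfree _⟩
  exact ⟨M, ⟨((QuotientGroup.quotientMulEquivOfEq hker.symm).trans
    (QuotientGroup.quotientKerEquivOfSurjective φ hφ)).symm⟩⟩

/-- Right multiplication by `n⁻¹`, as a permutation of the left cosets of `M` when `n` normalises
`M`. The cosets are lifted to an arbitrary universe. -/
def cosetRightMul (M : Subgroup Γ) :
    Subgroup.normalizer (M : Set Γ) →* Equiv.Perm (ULift.{v} (Γ ⧸ M)) :=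
  MonoidHom.toHomPerm
    { toFun := fun n x => ⟨Quotient.map' (fun g => g * (n : Γ)⁻¹) (fun g h hgh => by
        rw [QuotientGroup.leftRel_apply] at hgh ⊢
        have := (Subgroup.mem_normalizer_iff.1 n.2 (g⁻¹ * h)).1 hgh
        simpa [mul_assoc] using this) x.down⟩
      map_one' := by
        funext ⟨x⟩
        induction x using QuotientGroup.induction_on with
        | H g => exact congrArg ULift.up (congrArg (QuotientGroup.mk (s := M)) (by simp))
      map_mul' := fun m n => by
        funext ⟨x⟩
        induction x using QuotientGroup.induction_on with
        | H g => exact congrArg ULift.up (congrArg (QuotientGroup.mk (s := M))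
            (by simp [mul_assoc])) }

lemma cosetRightMul_apply (M : Subgroup Γ) (n : Subgroup.normalizer (M : Set Γ)) (g : Γ) :
    cosetRightMul.{v} M n ⟨(g : Γ ⧸ M)⟩ = ⟨((g * (n : Γ)⁻¹ : Γ) : Γ ⧸ M)⟩ := rfl

lemma ker_cosetRightMul (M : Subgroup Γ) :
    (cosetRightMul.{v} M).ker = M.subgroupOf (Subgroup.normalizer (M : Set Γ)) := by
  ext n
  rw [MonoidHom.mem_ker, Subgroup.mem_subgroupOf]
  constructor
  · intro h
    have := Equiv.congr_fun h ⟨((1 : Γ) : Γ ⧸ M)⟩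
    rw [cosetRightMul_apply] at this
    have := QuotientGroup.eq.1 (congrArg ULift.down this)
    simpa using this
  · intro h
    ext ⟨x⟩
    induction x using QuotientGroup.induction_on with
    | H g =>
      rw [cosetRightMul_apply]
      exact QuotientGroup.eq.2 (by simpa using h)

/-- Every permutation of `Γ ⧸ M` commuting with `Γ` is a right multiplication by an element of
the normaliser of `M`. -/
lemma range_cosetRightMul (M : Subgroup Γ) :
    (cosetRightMul.{v} M).range =
      Subgroup.centralizer (MulAction.toPermHom Γ (ULift.{v} (Γ ⧸ M))).range := by
  ext c
  rw [Subgroup.mem_centralizer_iff, MonoidHom.mem_range]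
  constructor
  · rintro ⟨n, rfl⟩ _ ⟨g, rfl⟩
    ext ⟨x⟩
    induction x using QuotientGroup.induction_on with
    | H h =>
      exact congrArg (QuotientGroup.mk (s := M)) (mul_assoc g h _).symm
  · intro hc
    have hc' (g : Γ) (x : ULift.{v} (Γ ⧸ M)) : c (g • x) = g • c x :=
      (Equiv.congr_fun (hc _ ⟨g, rfl⟩) x).symm
    have hbase (g h : Γ) : g • (⟨(h : Γ ⧸ M)⟩ : ULift.{v} (Γ ⧸ M)) = ⟨((g * h : Γ) : Γ ⧸ M)⟩ := rfl
    obtain ⟨γ, hγ⟩ := QuotientGroup.mk_surjective (c ⟨((1 : Γ) : Γ ⧸ M)⟩).down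
    have hcg (g : Γ) : c ⟨(g : Γ ⧸ M)⟩ = ⟨((g * γ : Γ) : Γ ⧸ M)⟩ := by
      have := hc' g ⟨((1 : Γ) : Γ ⧸ M)⟩
      rw [hbase, mul_one] at this
      rw [this, ← hbase, hγ]
    have hn : γ⁻¹ ∈ Subgroup.normalizer (M : Set Γ) := by
      rw [Subgroup.mem_normalizer_iff]
      intro m
      rw [inv_inv]
      have h1 : (c ⟨(m : Γ ⧸ M)⟩ = c ⟨((1 : Γ) : Γ ⧸ M)⟩) ↔ m ∈ M := by
        rw [c.injective.eq_iff, eq_comm, ULift.up_inj, QuotientGroup.eq]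
        simp
      rw [← h1, hcg, hcg, eq_comm, ULift.up_inj, QuotientGroup.eq]
      simp [mul_assoc]
    refine ⟨⟨γ⁻¹, hn⟩, ?_⟩
    ext ⟨x⟩
    induction x using QuotientGroup.induction_on with
    | H g => rw [cosetRightMul_apply, hcg]; simp

end Normalizer

namespace Hypermap

variable {p q r : ℕ∞}

/-- The hypermap given by a permutation representation of the extended triangle group. -/
def ofRep {X : Type v} (π : ExtendedTriangleGroup p q r →* Equiv.Perm X) :
    Hypermap.{v} p q r where
  Flag := X
  R i := π (PresentedGroup.of i)
  sq_eq_one i := by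
    rw [← map_pow, PresentedGroup.of, ← map_pow,
      PresentedGroup.one_of_mem (Or.inl ⟨i, rfl⟩), map_one]
  pow_p n hn := by
    rw [← map_mul, ← map_pow, PresentedGroup.of, PresentedGroup.of, ← map_mul, ← map_pow,
      PresentedGroup.one_of_mem (Or.inr (Or.inl ⟨n, hn, rfl⟩)), map_one]
  pow_q n hn := by
    rw [← map_mul, ← map_pow, PresentedGroup.of, PresentedGroup.of, ← map_mul, ← map_pow,
      PresentedGroup.one_of_mem (Or.inr (Or.inr (Or.inl ⟨n, hn, rfl⟩))), map_one]
  pow_r n hn := by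
    rw [← map_mul, ← map_pow, PresentedGroup.of, PresentedGroup.of, ← map_mul, ← map_pow,
      PresentedGroup.one_of_mem (Or.inr (Or.inr (Or.inr ⟨n, hn, rfl⟩))), map_one]

lemma rep_ofRep {X : Type v} (π : ExtendedTriangleGroup p q r →* Equiv.Perm X) :
    (ofRep π).rep = π :=
  PresentedGroup.ext fun _ => PresentedGroup.toGroup.of _

/-- A normaliser quotient in the extended triangle group is the automorphism group of the
hypermap on the cosets. -/
theorem exists_isConnected_aut_mulEquiv (M : Subgroup (ExtendedTriangleGroup p q r)) :
    ∃ H : Hypermap.{v} p q r, H.IsConnected ∧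
      Nonempty ((Subgroup.normalizer (M : Set (ExtendedTriangleGroup p q r)) ⧸
        M.subgroupOf (Subgroup.normalizer (M : Set (ExtendedTriangleGroup p q r)))) ≃* Aut H) := by
  let π := MulAction.toPermHom (ExtendedTriangleGroup p q r)
    (ULift.{v} (ExtendedTriangleGroup p q r ⧸ M))
  have hmon : (ofRep π).monodromyGroup = π.range := by rw [monodromyGroup, rep_ofRep]; rfl
  refine ⟨ofRep π, ⟨⟨(⟨((1 : ExtendedTriangleGroup p q r) : _ ⧸ M)⟩ : ULift.{v} _)⟩, ?_⟩, ⟨?_⟩⟩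
  · rintro ⟨x⟩ ⟨y⟩
    obtain ⟨g, rfl⟩ := MulAction.exists_smul_eq (ExtendedTriangleGroup p q r) x y
    exact ⟨π g, hmon ▸ ⟨g, rfl⟩, rfl⟩
  · let ψ : _ →* Equiv.Perm (ofRep π).Flag := cosetRightMul.{v} M
    have hψ : ψ.range =
        Subgroup.centralizer ((ofRep π).monodromyGroup : Set (Equiv.Perm (ofRep π).Flag)) := by
      rw [hmon]; exact range_cosetRightMul M
    exact (QuotientGroup.quotientMulEquivOfEq (ker_cosetRightMul.{v} M).symm).trans
      ((QuotientGroup.quotientKerEquivRange ψ).trans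
        ((MulEquiv.subgroupCongr hψ).trans (ofRep π).autEquivCentralizer.symm))

end Hypermap

/-! ### Orientable doubles -/

section Double

variable {E : Type*}

/-- The involution of `E × Bool` interchanging the two sheets, acting as `σ` from sheet `false`
to sheet `true` and as `σ⁻¹` back. -/
def sheetSwap (σ : Equiv.Perm E) : Equiv.Perm (E × Bool) where
  toFun x := match x with
    | (e, true) => (σ⁻¹ e, false)
    | (e, false) => (σ e, true)
  invFun x := match x with
    | (e, true) => (σ⁻¹ e, false)
    | (e, false) => (σ e, true)
  left_inv := by rintro ⟨e, _ | _⟩ <;> simp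
  right_inv := by rintro ⟨e, _ | _⟩ <;> simp

@[simp] lemma sheetSwap_true (σ : Equiv.Perm E) (e : E) :
    sheetSwap σ (e, true) = (σ⁻¹ e, false) := rfl

@[simp] lemma sheetSwap_false (σ : Equiv.Perm E) (e : E) :
    sheetSwap σ (e, false) = (σ e, true) := rfl

lemma sheetSwap_mul_self (σ : Equiv.Perm E) : sheetSwap σ * sheetSwap σ = 1 := by
  ext1 ⟨e, _ | _⟩ <;> simp

/-- The permutation of `E × Bool` acting as `σ` on sheet `true` and as `σ⁻¹` on sheet `false`. -/
def sheetTurn (σ : Equiv.Perm E) : Equiv.Perm (E × Bool) := sheetSwap σ * sheetSwap 1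

@[simp] lemma sheetTurn_true (σ : Equiv.Perm E) (e : E) : sheetTurn σ (e, true) = (σ e, true) := by
  simp [sheetTurn]

@[simp] lemma sheetTurn_false (σ : Equiv.Perm E) (e : E) :
    sheetTurn σ (e, false) = (σ⁻¹ e, false) := by
  simp [sheetTurn]

@[simp] lemma sheetTurn_inv_true (σ : Equiv.Perm E) (e : E) :
    (sheetTurn σ)⁻¹ (e, true) = (σ⁻¹ e, true) := by
  rw [Equiv.Perm.inv_eq_iff_eq]; simp

@[simp] lemma sheetTurn_inv_false (σ : Equiv.Perm E) (e : E) :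
    (sheetTurn σ)⁻¹ (e, false) = (σ e, false) := by
  rw [Equiv.Perm.inv_eq_iff_eq]; simp

lemma sheetTurn_pow (σ : Equiv.Perm E) (n : ℕ) (h : σ ^ n = 1) : sheetTurn σ ^ n = 1 := by
  have key (m : ℕ) (e : E) : (sheetTurn σ ^ m) (e, true) = ((σ ^ m) e, true) ∧
      (sheetTurn σ ^ m) (e, false) = ((σ ^ m)⁻¹ e, false) := by
    induction m with
    | zero => simp
    | succ m ih =>
      rw [pow_succ', Equiv.Perm.mul_apply, Equiv.Perm.mul_apply, ih.1, ih.2, pow_succ', mul_inv_rev,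
        ← inv_pow, (Commute.refl σ⁻¹).pow_left m]
      simp
  ext1 ⟨e, _ | _⟩ <;> simp [key, h]

/-- A permutation of `E` applied on both sheets. -/
def bothSheets : Equiv.Perm E →* Equiv.Perm (E × Bool) where
  toFun f := f.prodCongr (Equiv.refl Bool)
  map_one' := rfl
  map_mul' _ _ := rfl

@[simp] lemma bothSheets_apply (f : Equiv.Perm E) (x : E × Bool) :
    bothSheets f x = (f x.1, x.2) := rfl

lemma commute_sheetSwap_bothSheets {σ f : Equiv.Perm E} (h : Commute σ f) :
    Commute (sheetSwap σ) (bothSheets f) := by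
  ext1 ⟨e, _ | _⟩
  · simpa using Equiv.congr_fun h.eq e
  · simpa using Equiv.congr_fun h.inv_left.eq e

/-- The permutation `σ` moves `x` but fixes the two neighbours of `x` in its `τ`-cycle. The
condition is invariant under inverting `σ` and `τ`. -/
def IsLeaf (σ τ : Equiv.Perm E) (x : E) : Prop :=
  σ x ≠ x ∧ σ (τ x) = τ x ∧ σ (τ⁻¹ x) = τ⁻¹ x

lemma isLeaf_sheetTurn_true {σ τ : Equiv.Perm E} {e : E} :
    IsLeaf (sheetTurn σ) (sheetTurn τ) (e, true) ↔ IsLeaf σ τ e := by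
  simp [IsLeaf]

lemma isLeaf_sheetTurn_false {σ τ : Equiv.Perm E} {e : E} :
    IsLeaf (sheetTurn σ) (sheetTurn τ) (e, false) ↔ IsLeaf σ τ e := by
  have h (x : E) : σ⁻¹ x = x ↔ σ x = x := by rw [Equiv.Perm.inv_eq_iff_eq, eq_comm]
  simp only [IsLeaf, sheetTurn_false, sheetTurn_inv_false, ne_eq, Prod.mk.injEq, and_true, h]
  rw [and_comm (a := σ (τ⁻¹ e) = τ⁻¹ e)]

/-- The point `x` is a leaf, and so are the points reached from it by the words `σ` and `σ τ σ⁻¹`.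
On the sheet `false` of a double, where `σ` and `τ` act as their inverses, the condition on the
underlying point is the mirror image of that on the sheet `true`. -/
def IsMarked (σ τ : Equiv.Perm E) (x : E) : Prop :=
  IsLeaf σ τ x ∧ IsLeaf σ τ (σ x) ∧ IsLeaf σ τ (σ (τ (σ⁻¹ x)))

/-- Being marked is expressed by which words fix `x`, so it only depends on the stabiliser. -/
lemma IsMarked.of_stabilizer_eq {σ τ : Equiv.Perm E} {G : Subgroup (Equiv.Perm E)} (hσ : σ ∈ G)
    (hτ : τ ∈ G) {x y : E} (h : ∀ δ ∈ G, δ x = x ↔ δ y = y) (hy : IsMarked σ τ y) :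
    IsMarked σ τ x := by
  have key (δ γ : Equiv.Perm E) (hδ : δ ∈ G) (hγ : γ ∈ G) : δ (γ x) = γ x ↔ δ (γ y) = γ y := by
    have := h (γ⁻¹ * δ * γ) (mul_mem (mul_mem (inv_mem hγ) hδ) hγ)
    simpa only [Equiv.Perm.mul_apply, Equiv.Perm.inv_eq_iff_eq] using this
  have hleaf (γ : Equiv.Perm E) (hγ : γ ∈ G) : IsLeaf σ τ (γ x) ↔ IsLeaf σ τ (γ y) := by
    have h1 := key σ γ hσ hγ
    have h2 := key σ (τ * γ) hσ (mul_mem hτ hγ)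
    have h3 := key σ (τ⁻¹ * γ) hσ (mul_mem (inv_mem hτ) hγ)
    simp only [Equiv.Perm.mul_apply] at h2 h3
    simp only [IsLeaf, ne_eq, h1, h2, h3]
  exact ⟨(hleaf 1 (one_mem G)).2 hy.1, (hleaf σ hσ).2 hy.2.1,
    (hleaf (σ * (τ * σ⁻¹)) (mul_mem hσ (mul_mem hτ (inv_mem hσ)))).2 hy.2.2⟩

end Double

/-! ### A rigid voltage graph -/

namespace VoltageGraph

variable {s t : ℕ}

/-- The generator of order `t`: it turns every cell by one position. -/
def cellTurn (X : Type*) (s t : ℕ) : Equiv.Perm (X × (ℕ × ZMod s) × ZMod t) :=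
  (Equiv.refl X).prodCongr ((Equiv.refl (ℕ × ZMod s)).prodCongr (Equiv.addRight (1 : ZMod t)))

@[simp] lemma cellTurn_apply {X : Type*} (g : X) (k : ℕ × ZMod s) (j : ZMod t) :
    cellTurn X s t (g, k, j) = (g, k, j + 1) := rfl

@[simp] lemma cellTurn_inv_apply {X : Type*} (g : X) (k : ℕ × ZMod s) (j : ZMod t) :
    (cellTurn X s t)⁻¹ (g, k, j) = (g, k, j - 1) := by
  rw [Equiv.Perm.inv_eq_iff_eq]; simp

variable {A : Type*} [Group A]

/-- Port `i` of vertex `n` is primary when it has its own cell. The other ports are joined to a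
primary port of vertex `n - 1`. -/
def IsPrimary (n : ℕ) (i : ZMod s) : Prop :=
  i = 1 ∨ (i = 0 ∧ n ≤ 1) ∨ (i ≠ 0 ∧ Even n)

lemma isPrimary_one (n : ℕ) : IsPrimary n (1 : ZMod s) := Or.inl rfl

lemma isPrimary_iff_even {n : ℕ} {i : ZMod s} (h0 : i ≠ 0) (h1 : i ≠ 1) :
    IsPrimary n i ↔ Even n := by
  simp [IsPrimary, h0, h1]

open scoped Classical in
/-- The flag at port `i` of the vertex `n` in sheet `g` of the covering. A flag is given by its
sheet in `A`, its cell, labelled by a primary port, and its position in that cell. Port `1` of `n`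
is joined to port `0` of `n + 1` when `1 ≤ n`, and the ports `2, …, s - 1` of `2m` to those of
`2m + 1`, with voltage `a m`. Labels that are not primary ports give cells without ports. -/
noncomputable def port (s t : ℕ) (a : ℕ → A) (x : A × ℕ × ZMod s) : A × (ℕ × ZMod s) × ZMod t :=
  if IsPrimary x.2.1 x.2.2 then (x.1, x.2, 0)
  else (x.1 * (if x.2.2 = 0 then 1 else a (x.2.1 / 2)),
    (x.2.1 - 1, if x.2.2 = 0 then 1 else x.2.2), 1)

lemma port_of_isPrimary (a : ℕ → A) (g : A) {n : ℕ} {i : ZMod s} (h : IsPrimary n i) :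
    port s t a (g, n, i) = (g, (n, i), 0) := by
  simp [port, h]

lemma port_of_not_isPrimary (a : ℕ → A) (g : A) {n : ℕ} {i : ZMod s} (h : ¬ IsPrimary n i) :
    port s t a (g, n, i) =
      (g * (if i = 0 then 1 else a (n / 2)), (n - 1, if i = 0 then 1 else i), 1) := by
  simp [port, h]

/-- Left multiplication by `x` on the first component. -/
def deck (X : Type*) : A →* Equiv.Perm (A × X) where
  toFun x := (Equiv.mulLeft x).prodCongr (Equiv.refl X)
  map_one' := by ext1 ⟨g, y⟩; simp
  map_mul' x y := by ext1 ⟨g, z⟩; simp [mul_assoc]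

@[simp] lemma deck_apply {X : Type*} (x g : A) (y : X) : deck X x (g, y) = (x * g, y) := rfl

lemma port_deck (a : ℕ → A) (x : A) (y : A × ℕ × ZMod s) :
    port s t a (deck _ x y) = deck _ x (port s t a y) := by
  obtain ⟨g, n, i⟩ := y
  by_cases h : IsPrimary n i
  · simp [port_of_isPrimary, h]
  · simp [port_of_not_isPrimary, h, mul_assoc]

section

variable [Fact (2 < s)] [Fact (1 < t)]

instance : Fact (1 < s) := ⟨lt_trans one_lt_two (Fact.out : 2 < s)⟩

instance : NeZero s := ⟨by have := (Fact.out : 2 < s); omega⟩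

lemma two_ne_zero_zmod : (2 : ZMod s) ≠ 0 := by
  intro h
  have h' : ((2 : ℕ) : ZMod s) = 0 := by exact_mod_cast h
  rw [ZMod.natCast_eq_zero_iff] at h'
  exact absurd (Nat.le_of_dvd two_pos h') (not_le.2 Fact.out)

lemma two_ne_one_zmod : (2 : ZMod s) ≠ 1 := by
  intro h
  have : (1 : ZMod s) = 0 := by linear_combination h
  exact one_ne_zero this

lemma neg_one_ne_one_zmod : (-1 : ZMod s) ≠ 1 := by
  intro h
  exact two_ne_zero_zmod (s := s) (by linear_combination -h)

lemma isPrimary_zero_iff {n : ℕ} : IsPrimary n (0 : ZMod s) ↔ n ≤ 1 := by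
  simp [IsPrimary]

lemma port_injective (a : ℕ → A) : Function.Injective (port s t a) := by
  have h01 : (0 : ZMod t) ≠ 1 := zero_ne_one
  rintro ⟨g, n, i⟩ ⟨h, m, j⟩ e
  by_cases hi : IsPrimary n i <;> by_cases hj : IsPrimary m j
  · rw [port_of_isPrimary a g hi, port_of_isPrimary a h hj] at e
    simp_all
  · rw [port_of_isPrimary a g hi, port_of_not_isPrimary a h hj] at e
    simp_all
  · rw [port_of_not_isPrimary a g hi, port_of_isPrimary a h hj] at e
    simp_all
  · rw [port_of_not_isPrimary a g hi, port_of_not_isPrimary a h hj] at e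
    simp only [Prod.mk.injEq, and_true] at e
    obtain ⟨e1, e2, e3⟩ := e
    have hi1 : i ≠ 1 := fun h => hi (Or.inl h)
    have hj1 : j ≠ 1 := fun h => hj (Or.inl h)
    have hn : n ≠ 0 := by rintro rfl; exact hi (by by_cases i = 0 <;> simp_all [IsPrimary])
    have hm : m ≠ 0 := by rintro rfl; exact hj (by by_cases j = 0 <;> simp_all [IsPrimary])
    have hnm : n = m := by omega
    have hij : i = j := by
      by_cases hi0 : i = 0 <;> by_cases hj0 : j = 0 <;> simp_all
    subst hnm hij
    rw [mul_right_cancel e1]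

/-- The generator of order `s`: it turns every vertex by one port, and fixes the flags that are
not at a port. -/
noncomputable def vertexTurn (s t : ℕ) [Fact (2 < s)] [Fact (1 < t)] (a : ℕ → A) :
    Equiv.Perm (A × (ℕ × ZMod s) × ZMod t) :=
  Equiv.Perm.viaEmbedding
    ((Equiv.refl A).prodCongr ((Equiv.refl ℕ).prodCongr (Equiv.addRight (1 : ZMod s))))
    ⟨port s t a, port_injective a⟩

lemma vertexTurn_port (a : ℕ → A) (g : A) (n : ℕ) (i : ZMod s) :
    vertexTurn s t a (port s t a (g, n, i)) = port s t a (g, n, i + 1) :=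
  Equiv.Perm.viaEmbedding_apply _ ⟨port s t a, port_injective a⟩ (g, n, i)

lemma vertexTurn_inv_port (a : ℕ → A) (g : A) (n : ℕ) (i : ZMod s) :
    (vertexTurn s t a)⁻¹ (port s t a (g, n, i)) = port s t a (g, n, i - 1) := by
  rw [Equiv.Perm.inv_eq_iff_eq, vertexTurn_port, sub_add_cancel]

lemma vertexTurn_of_notMem (a : ℕ → A) {e : A × (ℕ × ZMod s) × ZMod t}
    (h : e ∉ Set.range (port s t a)) : vertexTurn s t a e = e :=
  Equiv.Perm.viaEmbedding_apply_of_notMem _ ⟨port s t a, port_injective a⟩ e h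

lemma vertexTurn_eq_self_iff (a : ℕ → A) (e : A × (ℕ × ZMod s) × ZMod t) :
    vertexTurn s t a e = e ↔ e ∉ Set.range (port s t a) := by
  refine ⟨?_, vertexTurn_of_notMem a⟩
  rintro h ⟨⟨g, n, i⟩, rfl⟩
  rw [vertexTurn_port] at h
  simpa using port_injective a h

lemma vertexTurn_pow (a : ℕ → A) : vertexTurn s t a ^ s = 1 := by
  let f : Equiv.Perm (A × ℕ × ZMod s) :=
    (Equiv.refl A).prodCongr ((Equiv.refl ℕ).prodCongr (Equiv.addRight (1 : ZMod s)))
  have key (m : ℕ) (g : A) (n : ℕ) (i : ZMod s) : (f ^ m) (g, n, i) = (g, n, i + m) := by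
    induction m with
    | zero => simp
    | succ m ih =>
      rw [pow_succ', Equiv.Perm.mul_apply, ih]
      simp [f, add_assoc]
  have hf : f ^ s = 1 := by
    ext1 ⟨g, n, i⟩
    simp [key]
  change (Equiv.Perm.viaEmbeddingHom ⟨port s t a, port_injective a⟩ f) ^ s = 1
  rw [← map_pow, hf, map_one]

omit [Fact (2 < s)] [Fact (1 < t)] in
lemma cellTurn_pow (X : Type*) (s t : ℕ) : cellTurn X s t ^ t = 1 := by
  have key (m : ℕ) (g : X) (k : ℕ × ZMod s) (j : ZMod t) :
      (cellTurn X s t ^ m) (g, k, j) = (g, k, j + m) := by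
    induction m with
    | zero => simp
    | succ m ih =>
      rw [pow_succ', Equiv.Perm.mul_apply, ih]
      simp [add_assoc]
  ext1 ⟨g, k, j⟩
  simp [key]

lemma commute_vertexTurn_deck (a : ℕ → A) (x : A) :
    Commute (vertexTurn s t a) (deck _ x) := by
  ext1 e
  rw [Equiv.Perm.mul_apply, Equiv.Perm.mul_apply]
  by_cases h : e ∈ Set.range (port s t a)
  · obtain ⟨⟨g, n, i⟩, rfl⟩ := h
    rw [← port_deck, deck_apply, vertexTurn_port, vertexTurn_port, ← port_deck, deck_apply]
  · rw [vertexTurn_of_notMem a h, vertexTurn_of_notMem]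
    rintro ⟨y, hy⟩
    refine h ⟨deck _ x⁻¹ y, ?_⟩
    rw [port_deck, hy, map_inv]
    exact (deck _ x).symm_apply_apply e

omit [Fact (2 < s)] [Fact (1 < t)] in
lemma commute_cellTurn_deck (x : A) : Commute (cellTurn A s t) (deck _ x) := rfl

/-- The three ports whose cell contains no other port. -/
def IsLeafPort (n : ℕ) (i : ZMod s) : Prop :=
  (n = 0 ∧ i = 0) ∨ (n = 0 ∧ i = 1) ∨ (n = 1 ∧ i = 0)

lemma IsLeafPort.isPrimary {n : ℕ} {i : ZMod s} (h : IsLeafPort n i) : IsPrimary n i := by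
  rcases h with ⟨rfl, rfl⟩ | ⟨rfl, rfl⟩ | ⟨rfl, rfl⟩ <;> simp [IsPrimary]

omit [Fact (1 < t)] in
lemma IsLeafPort.notMem_range_port (a : ℕ → A) (g : A) {n : ℕ} {i : ZMod s}
    (h : IsLeafPort n i) {j : ZMod t} (hj : j ≠ 0) : (g, (n, i), j) ∉ Set.range (port s t a) := by
  rintro ⟨⟨g', m, k⟩, e⟩
  by_cases hk : IsPrimary m k
  · rw [port_of_isPrimary a g' hk] at e
    simp_all
  · rw [port_of_not_isPrimary a g' hk] at e
    simp only [Prod.mk.injEq] at e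
    obtain ⟨-, ⟨hn, hi⟩, -⟩ := e
    have hk1 : k ≠ 1 := fun h => hk (Or.inl h)
    by_cases hk0 : k = 0
    · subst hk0
      rw [isPrimary_zero_iff] at hk
      rcases h with ⟨rfl, rfl⟩ | ⟨rfl, rfl⟩ | ⟨rfl, rfl⟩
      · omega
      · omega
      · simp at hi
    · rw [if_neg hk0] at hi
      subst hi
      rcases h with h | h | h
      · exact hk0 h.2
      · exact hk1 h.2
      · exact hk0 h.2

lemma isLeaf_port_iff (a : ℕ → A) (g : A) (n : ℕ) (i : ZMod s) :
    IsLeaf (vertexTurn s t a) (cellTurn A s t) (port s t a (g, n, i)) ↔ IsLeafPort n i := by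
  rw [IsLeaf, ne_eq, vertexTurn_eq_self_iff, vertexTurn_eq_self_iff, vertexTurn_eq_self_iff]
  constructor
  · rintro ⟨-, h1, h2⟩
    by_cases hp : IsPrimary n i
    · rw [port_of_isPrimary a g hp, cellTurn_apply, zero_add] at h1
      by_cases hi1 : i = 1
      · subst hi1
        rcases Nat.eq_zero_or_pos n with hn | hn
        · exact Or.inr (Or.inl ⟨hn, rfl⟩)
        · refine absurd ⟨(g, n + 1, 0), ?_⟩ h1
          rw [port_of_not_isPrimary a g (by rw [isPrimary_zero_iff]; omega)]
          simp
      by_cases hi0 : i = 0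
      · subst hi0
        rw [isPrimary_zero_iff] at hp
        rcases (by omega : n = 0 ∨ n = 1) with hn | hn
        · exact Or.inl ⟨hn, rfl⟩
        · exact Or.inr (Or.inr ⟨hn, rfl⟩)
      · rw [isPrimary_iff_even hi0 hi1] at hp
        refine absurd ⟨(g * (a ((n + 1) / 2))⁻¹, n + 1, i), ?_⟩ h1
        rw [port_of_not_isPrimary a _ (by rw [isPrimary_iff_even hi0 hi1]; grind)]
        simp [hi0]
    · rw [port_of_not_isPrimary a g hp, cellTurn_inv_apply, sub_self] at h2
      refine absurd ⟨(_, _, _), port_of_isPrimary a _ ?_⟩ h2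
      have hi1 : i ≠ 1 := fun h => hp (Or.inl h)
      by_cases hi0 : i = 0
      · simp [hi0, IsPrimary]
      · rw [isPrimary_iff_even hi0 hi1] at hp
        rw [if_neg hi0, isPrimary_iff_even hi0 hi1]
        grind
  · intro h
    refine ⟨not_not.2 ⟨_, rfl⟩, ?_⟩
    rw [port_of_isPrimary a g h.isPrimary, cellTurn_apply, cellTurn_inv_apply]
    exact ⟨h.notMem_range_port a g (by simp), h.notMem_range_port a g (by simp)⟩

lemma exists_eq_port_of_isLeaf {a : ℕ → A} {e : A × (ℕ × ZMod s) × ZMod t}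
    (h : IsLeaf (vertexTurn s t a) (cellTurn A s t) e) :
    ∃ g n i, IsLeafPort n i ∧ e = port s t a (g, n, i) := by
  obtain ⟨⟨g, n, i⟩, rfl⟩ := not_not.1 (mt (vertexTurn_eq_self_iff a e).2 h.1)
  exact ⟨g, n, i, (isLeaf_port_iff a g n i).1 h, rfl⟩

omit [Fact (1 < t)] in
lemma not_isLeafPort_neg_one (n : ℕ) : ¬ IsLeafPort n (-1 : ZMod s) := by
  simp [IsLeafPort, neg_one_ne_one_zmod]

omit [Fact (1 < t)] in
lemma not_isLeafPort_two (n : ℕ) : ¬ IsLeafPort n (2 : ZMod s) := by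
  simp [IsLeafPort, two_ne_zero_zmod, two_ne_one_zmod]

/-- On the first sheet, only the flags at port `0` of vertex `0` are marked. -/
lemma isMarked_true_iff {a : ℕ → A} (ha : a 0 = 1) (e : A × (ℕ × ZMod s) × ZMod t) :
    IsMarked (sheetTurn (vertexTurn s t a)) (sheetTurn (cellTurn A s t)) (e, true) ↔
      ∃ g, e = port s t a (g, 0, 0) := by
  simp only [IsMarked, sheetTurn_true, sheetTurn_inv_true, isLeaf_sheetTurn_true]
  constructor
  · rintro ⟨h1, h2, -⟩
    obtain ⟨g, n, i, hi, rfl⟩ := exists_eq_port_of_isLeaf h1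
    rw [vertexTurn_port, isLeaf_port_iff] at h2
    rcases hi with ⟨rfl, rfl⟩ | ⟨rfl, rfl⟩ | ⟨rfl, rfl⟩
    · exact ⟨g, rfl⟩
    · rw [one_add_one_eq_two] at h2
      exact absurd h2 (not_isLeafPort_two 0)
    · simp [IsLeafPort] at h2
  · rintro ⟨g, rfl⟩
    have h0 : (-1 : ZMod s) ≠ 0 := by simp
    have h1 := neg_one_ne_one_zmod (s := s)
    have hjoin : cellTurn A s t (port s t a (g, 0, -1)) = port s t a (g, 1, -1) := by
      rw [port_of_isPrimary a g ((isPrimary_iff_even h0 h1).2 Even.zero),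
        port_of_not_isPrimary a g (by simp [isPrimary_iff_even h0 h1])]
      simp [ha]
    rw [vertexTurn_port, vertexTurn_inv_port, zero_sub, hjoin, vertexTurn_port, neg_add_cancel]
    simp [isLeaf_port_iff, IsLeafPort]

/-- No flag on the second sheet is marked: reading the defining words backwards distinguishes the
map from its mirror image. -/
lemma not_isMarked_false (a : ℕ → A) (e : A × (ℕ × ZMod s) × ZMod t) :
    ¬ IsMarked (sheetTurn (vertexTurn s t a)) (sheetTurn (cellTurn A s t)) (e, false) := by
  simp only [IsMarked, sheetTurn_false, sheetTurn_inv_false, isLeaf_sheetTurn_false]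
  rintro ⟨h1, h2, h3⟩
  obtain ⟨g, n, i, hi, rfl⟩ := exists_eq_port_of_isLeaf h1
  rw [vertexTurn_inv_port, isLeaf_port_iff] at h2
  rw [vertexTurn_port] at h3
  rcases hi with ⟨rfl, rfl⟩ | ⟨rfl, rfl⟩ | ⟨rfl, rfl⟩
  · rw [zero_sub] at h2
    exact not_isLeafPort_neg_one 0 h2
  · have hp : IsPrimary 0 (2 : ZMod s) :=
      (isPrimary_iff_even two_ne_zero_zmod two_ne_one_zmod).2 Even.zero
    rw [one_add_one_eq_two, port_of_isPrimary a g hp, cellTurn_inv_apply, zero_sub] at h3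
    obtain ⟨g', m, k, hk, he⟩ := exists_eq_port_of_isLeaf h3
    rw [Equiv.Perm.inv_eq_iff_eq, vertexTurn_port] at he
    have h21 := two_ne_one_zmod (s := s)
    -- The port after a leaf port is never at the position just before port `2` of vertex `0`.
    rcases hk with ⟨rfl, rfl⟩ | ⟨rfl, rfl⟩ | ⟨rfl, rfl⟩
    · rw [zero_add, port_of_isPrimary a g' (isPrimary_one 0)] at he
      simp at he
    · rw [one_add_one_eq_two, port_of_isPrimary a g' hp] at he
      simp at he
    · rw [zero_add, port_of_isPrimary a g' (isPrimary_one 1)] at he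
      simp at he
  · rw [zero_sub] at h2
    exact not_isLeafPort_neg_one 1 h2

/-- If the voltages run over `A`, the fibre of the covering over port `0` of vertex `0` lies in
one orbit. -/
lemma rel_port_of_surjective {a : ℕ → A} (ha : a 0 = 1) (hsurj : Function.Surjective a)
    {r : A × (ℕ × ZMod s) × ZMod t → A × (ℕ × ZMod s) × ZMod t → Prop} (hr : Equivalence r)
    (hvertex : ∀ e, r e (vertexTurn s t a e)) (hcell : ∀ e, r e (cellTurn A s t e)) (x : A) :
    r (port s t a (1, 0, 0)) (port s t a (x, 0, 0)) := by
  have hport (g : A) (n : ℕ) (i : ZMod s) : r (port s t a (g, n, 0)) (port s t a (g, n, i)) := by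
    rw [← ZMod.natCast_zmod_val i]
    induction i.val with
    | zero => simpa using hr.refl _
    | succ k ih =>
      refine hr.trans ih ?_
      have := hvertex (port s t a (g, n, (k : ZMod s)))
      rwa [vertexTurn_port, ← Nat.cast_succ] at this
  have hpath (g : A) (n : ℕ) (hn : 1 ≤ n) :
      r (port s t a (g, n, 0)) (port s t a (g, n + 1, 0)) := by
    refine hr.trans (hport g n 1) ?_
    have := hcell (port s t a (g, n, 1))
    rw [port_of_isPrimary a g (isPrimary_one n), cellTurn_apply] at this
    rw [port_of_isPrimary a g (isPrimary_one n),
      port_of_not_isPrimary a g (by rw [isPrimary_zero_iff]; omega)]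
    simpa using this
  have hchord (g : A) (m : ℕ) :
      r (port s t a (g * a m, 2 * m, 0)) (port s t a (g, 2 * m + 1, 0)) := by
    have h20 := two_ne_zero_zmod (s := s)
    have h21 := two_ne_one_zmod (s := s)
    have hp : IsPrimary (2 * m) (2 : ZMod s) := (isPrimary_iff_even h20 h21).2 (by simp)
    refine hr.trans (hport _ _ 2) (hr.symm (hr.trans (hport _ _ 2) (hr.symm ?_)))
    have := hcell (port s t a (g * a m, 2 * m, 2))
    rw [port_of_isPrimary a _ hp, cellTurn_apply] at this
    rw [port_of_isPrimary a _ hp, port_of_not_isPrimary a g (by simp [isPrimary_iff_even h20 h21]),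
      if_neg h20, if_neg h20, (by omega : (2 * m + 1) / 2 = m)]
    simpa using this
  have hall (g : A) (n : ℕ) : r (port s t a (g, 0, 0)) (port s t a (g, n, 0)) := by
    induction n with
    | zero => exact hr.refl _
    | succ n ih =>
      rcases Nat.eq_zero_or_pos n with rfl | hn
      · simpa [ha] using hchord g 0
      · exact hr.trans ih (hpath g n hn)
  obtain ⟨m, rfl⟩ := hsurj x
  have h := hchord 1 m
  rw [one_mul] at h
  exact hr.trans (hall 1 _) (hr.symm (hr.trans (hall _ _) h))

end

end VoltageGraph

/-! ### Realisation in extended triangle groups -/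

/-- If `Γ` maps onto every group of permutations generated by three involutions `a`, `b`, `c` with
`(a c) ^ s = (b c) ^ t = 1`, then every countable group is a normaliser quotient in `Γ`. -/
theorem exists_normalizer_quotient_of_hom {Γ : Type w} [Group Γ] {s t : ℕ} (hs : 2 < s)
    (ht : 1 < t)
    (hΓ : ∀ (Ω : Type u) (a b c : Equiv.Perm Ω), a * a = 1 → b * b = 1 → c * c = 1 →
      (a * c) ^ s = 1 → (b * c) ^ t = 1 →
      ∃ ρ : Γ →* Equiv.Perm Ω, ρ.range = Subgroup.closure {a, b, c}) :
    GroupHasCARP.{u} Γ := by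
  intro A _ _
  have : Fact (2 < s) := ⟨hs⟩
  have : Fact (1 < t) := ⟨ht⟩
  obtain ⟨f, hf⟩ := exists_surjective_nat A
  let a : ℕ → A := fun n => n.casesOn 1 f
  have ha : a 0 = 1 := rfl
  have hsurj : Function.Surjective a := fun x => (hf x).imp' Nat.succ fun _ h => h
  let σ := VoltageGraph.vertexTurn s t a
  let τ := VoltageGraph.cellTurn A s t
  obtain ⟨ρ, hρ⟩ := hΓ _ (sheetSwap σ) (sheetSwap τ) (sheetSwap 1) (sheetSwap_mul_self _)
    (sheetSwap_mul_self _) (sheetSwap_mul_self _)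
    (sheetTurn_pow σ s (VoltageGraph.vertexTurn_pow a))
    (sheetTurn_pow τ t (VoltageGraph.cellTurn_pow A s t))
  have hSσ : sheetSwap σ ∈ ρ.range := hρ ▸ Subgroup.subset_closure (by simp)
  have hSτ : sheetSwap τ ∈ ρ.range := hρ ▸ Subgroup.subset_closure (by simp)
  have hS1 : sheetSwap 1 ∈ ρ.range := hρ ▸ Subgroup.subset_closure (by simp)
  have hTσ : sheetTurn σ ∈ ρ.range := mul_mem hSσ hS1
  have hTτ : sheetTurn τ ∈ ρ.range := mul_mem hSτ hS1
  let α := bothSheets.comp (VoltageGraph.deck (A := A) ((ℕ × ZMod s) × ZMod t))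
  let ω := (VoltageGraph.port s t a (1, 0, 0), true)
  have hα (x : A) : α x ω = (VoltageGraph.port s t a (x, 0, 0), true) := by
    simp [α, ω, ← VoltageGraph.port_deck]
  refine exists_subgroup_mulEquiv_normalizer_quotient ρ α ω ?_ ?_ ?_ ?_
  · intro γ x
    have hle : Subgroup.closure {sheetSwap σ, sheetSwap τ, sheetSwap 1} ≤
        Subgroup.centralizer {α x} := by
      rw [Subgroup.closure_le]
      rintro _ (rfl | rfl | rfl) <;> rw [SetLike.mem_coe, Subgroup.mem_centralizer_singleton_iff]
      · exact (commute_sheetSwap_bothSheets (VoltageGraph.commute_vertexTurn_deck a x)).eq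
      · exact (commute_sheetSwap_bothSheets (VoltageGraph.commute_cellTurn_deck x)).eq
      · exact (commute_sheetSwap_bothSheets (Commute.one_left _)).eq
    exact Subgroup.mem_centralizer_singleton_iff.1 (hle (hρ ▸ ⟨γ, rfl⟩))
  · intro x hx
    rw [hα] at hx
    simpa using VoltageGraph.port_injective a (congrArg Prod.fst hx)
  · intro x
    let r : A × (ℕ × ZMod s) × ZMod t → A × (ℕ × ZMod s) × ZMod t → Prop :=
      fun e e' => ∃ γ, ρ γ (e, true) = (e', true)
    have hr : Equivalence r :=
      { refl := fun e => ⟨1, by simp⟩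
        symm := by
          rintro e e' ⟨γ, h⟩
          exact ⟨γ⁻¹, by rw [map_inv, Equiv.Perm.inv_eq_iff_eq, h]⟩
        trans := by
          rintro e e' e'' ⟨γ, h⟩ ⟨δ, h'⟩
          exact ⟨δ * γ, by rw [map_mul, Equiv.Perm.mul_apply, h, h']⟩ }
    obtain ⟨γ, hγ⟩ := VoltageGraph.rel_port_of_surjective ha hsurj hr
      (fun e => by
        obtain ⟨γ, hγ⟩ := hTσ
        exact ⟨γ, by rw [hγ, sheetTurn_true]⟩)
      (fun e => by
        obtain ⟨γ, hγ⟩ := hTτ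
        exact ⟨γ, by rw [hγ, sheetTurn_true]⟩) x
    exact ⟨γ, hγ.trans (hα x).symm⟩
  · intro γ hγ
    have hmark : IsMarked (sheetTurn σ) (sheetTurn τ) (ρ γ ω) := by
      refine IsMarked.of_stabilizer_eq hTσ hTτ (y := ω) ?_
        ((VoltageGraph.isMarked_true_iff ha _).2 ⟨1, rfl⟩)
      rintro _ ⟨δ, rfl⟩
      exact hγ δ
    generalize ρ γ ω = z at hmark ⊢
    obtain ⟨e, b⟩ := z
    cases b with
    | false => exact absurd hmark (VoltageGraph.not_isMarked_false a e)
    | true =>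
      obtain ⟨x, rfl⟩ := (VoltageGraph.isMarked_true_iff ha e).1 hmark
      exact ⟨x, (hα x).symm⟩

lemma powEqOne_of_pow_eq_one {G : Type*} [Group G] {g : G} {n : ℕ} {p : ℕ∞} (h : g ^ n = 1)
    (hp : ∀ m : ℕ, p = m → n ∣ m) : PowEqOne g p := by
  intro m hm
  obtain ⟨k, rfl⟩ := hp m hm
  rw [pow_mul, h, one_pow]

/-- The product of two involutions and the product in the other order are mutually inverse. -/
lemma pow_mul_comm_eq_one {G : Type*} [Group G] {x y : G} (hx : x * x = 1) (hy : y * y = 1)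
    {n : ℕ} (h : (x * y) ^ n = 1) : (y * x) ^ n = 1 := by
  have : y * x = (x * y)⁻¹ := by
    rw [mul_inv_rev, inv_eq_of_mul_eq_one_left hx, inv_eq_of_mul_eq_one_left hy]
  rw [this, inv_pow, h, inv_one]

lemma exists_extendedTriangleGroup_hom {p q r : ℕ∞} {Ω : Type*} (R : Fin 3 → Equiv.Perm Ω)
    (hR : ∀ i, R i * R i = 1) (hp : PowEqOne (R 1 * R 2) p) (hq : PowEqOne (R 2 * R 0) q)
    (hr : PowEqOne (R 0 * R 1) r) :
    ∃ ρ : ExtendedTriangleGroup p q r →* Equiv.Perm Ω,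
      ρ.range = Subgroup.closure {R 0, R 1, R 2} := by
  let H : Hypermap p q r := ⟨Ω, R, fun i => by rw [sq, hR], hp, hq, hr⟩
  refine ⟨H.rep, ?_⟩
  have hof (i : Fin 3) : H.rep (PresentedGroup.of i) = R i := PresentedGroup.toGroup.of _
  rw [MonoidHom.range_eq_map, ← PresentedGroup.closure_range_of, MonoidHom.map_closure]
  congr 1
  ext x
  simp [Fin.exists_fin_succ, hof, eq_comm]

/-- A pair of periods that are at least `2`, and not both `2`, has finite divisors with the same
property; every natural number is regarded as a divisor of `∞`. -/
lemma exists_periods {x y : ℕ∞} (h : (x : ℝ≥0∞)⁻¹ + (y : ℝ≥0∞)⁻¹ < 1) :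
    ∃ s t : ℕ, 2 < s ∧ 1 < t ∧ (((∀ m : ℕ, x = m → s ∣ m) ∧ (∀ m : ℕ, y = m → t ∣ m)) ∨
      ((∀ m : ℕ, x = m → t ∣ m) ∧ (∀ m : ℕ, y = m → s ∣ m))) := by
  have hlow {x y : ℕ∞} (h : (x : ℝ≥0∞)⁻¹ + (y : ℝ≥0∞)⁻¹ < 1) (m : ℕ) (hm : x = m) : 1 < m := by
    subst hm
    by_contra! hle
    refine absurd (le_self_add.trans_lt h) (not_lt.2 (ENNReal.one_le_inv.2 ?_))
    exact_mod_cast hle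
  have hlarge {x y : ℕ∞} (h : (x : ℝ≥0∞)⁻¹ + (y : ℝ≥0∞)⁻¹ < 1) (hx : x ≠ 2) :
      ∃ s t : ℕ, 2 < s ∧ 1 < t ∧ (∀ m : ℕ, x = m → s ∣ m) ∧ (∀ m : ℕ, y = m → t ∣ m) := by
    have hx' : ∃ s : ℕ, 2 < s ∧ ∀ m : ℕ, x = m → s ∣ m := by
      induction x using ENat.recTopCoe with
      | top => exact ⟨3, by norm_num, fun m hm => absurd hm (ENat.top_ne_natCast m)⟩
      | coe n =>
        have := hlow h n rfl
        have h2 : n ≠ 2 := by rintro rfl; exact hx rfl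
        exact ⟨n, by omega, fun m hm => by rw [Nat.cast_inj.1 hm]⟩
    have hy' : ∃ t : ℕ, 1 < t ∧ ∀ m : ℕ, y = m → t ∣ m := by
      induction y using ENat.recTopCoe with
      | top => exact ⟨2, by norm_num, fun m hm => absurd hm (ENat.top_ne_natCast m)⟩
      | coe n =>
        rw [add_comm] at h
        exact ⟨n, hlow h n rfl, fun m hm => by rw [Nat.cast_inj.1 hm]⟩
    obtain ⟨s, hs, hxs⟩ := hx'
    obtain ⟨t, ht, hyt⟩ := hy'
    exact ⟨s, t, hs, ht, hxs, hyt⟩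
  by_cases hx : x = 2
  · have hy : y ≠ 2 := by
      rintro rfl
      subst hx
      refine absurd h (not_lt.2 (le_of_eq ?_))
      exact ENNReal.inv_two_add_inv_two.symm
    rw [add_comm] at h
    obtain ⟨s, t, hs, ht, h1, h2⟩ := hlarge h hy
    exact ⟨s, t, hs, ht, Or.inr ⟨h2, h1⟩⟩
  · obtain ⟨s, t, hs, ht, h1, h2⟩ := hlarge h hx
    exact ⟨s, t, hs, ht, Or.inl ⟨h1, h2⟩⟩

/-- The same criterion for a pair of possibly infinite periods. It is symmetric in them, because
`a` and `b` can be interchanged. -/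
theorem groupHasCARP_of_hom {Γ : Type w} [Group Γ] {x y : ℕ∞}
    (h : (x : ℝ≥0∞)⁻¹ + (y : ℝ≥0∞)⁻¹ < 1)
    (hΓ : ∀ (Ω : Type u) (a b c : Equiv.Perm Ω), a * a = 1 → b * b = 1 → c * c = 1 →
      PowEqOne (a * c) x → PowEqOne (c * b) y →
      ∃ ρ : Γ →* Equiv.Perm Ω, ρ.range = Subgroup.closure {a, b, c}) :
    GroupHasCARP.{u} Γ := by
  obtain ⟨s, t, hs, ht, ⟨hx, hy⟩ | ⟨hx, hy⟩⟩ := exists_periods h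
  · refine exists_normalizer_quotient_of_hom hs ht fun Ω a b c ha hb hc hac hbc => ?_
    exact hΓ Ω a b c ha hb hc (powEqOne_of_pow_eq_one hac hx)
      (powEqOne_of_pow_eq_one (pow_mul_comm_eq_one hb hc hbc) hy)
  · refine exists_normalizer_quotient_of_hom hs ht fun Ω a b c ha hb hc hac hbc => ?_
    rw [Set.insert_comm]
    exact hΓ Ω b a c hb ha hc (powEqOne_of_pow_eq_one hbc hx)
      (powEqOne_of_pow_eq_one (pow_mul_comm_eq_one ha hc hac) hy)

theorem groupHasCARP_extendedTriangleGroup {p q r : ℕ∞} (hyp : IsHyperbolicTriple p q r)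
    (hinf : p = ⊤ ∨ q = ⊤ ∨ r = ⊤) : GroupHasCARP.{u} (ExtendedTriangleGroup p q r) := by
  have htop {G : Type u} [Group G] (g : G) : PowEqOne g ⊤ :=
    fun m hm => absurd hm (ENat.top_ne_natCast m)
  unfold IsHyperbolicTriple at hyp
  -- The involution common to the two remaining periods is `R₀`, `R₁`, `R₂` respectively.
  rcases hinf with rfl | rfl | rfl
  · refine groupHasCARP_of_hom (x := q) (y := r) (by simpa using hyp)
      fun Ω a b c ha hb hc hac hcb => ?_
    obtain ⟨ρ, hρ⟩ := exists_extendedTriangleGroup_hom ![c, b, a]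
      (by simp [Fin.forall_fin_succ, ha, hb, hc]) (htop _) hac hcb
    exact ⟨ρ, hρ.trans (congrArg _ (by ext; simp; tauto))⟩
  · refine groupHasCARP_of_hom (x := r) (y := p) (by simpa [add_comm] using hyp)
      fun Ω a b c ha hb hc hac hcb => ?_
    obtain ⟨ρ, hρ⟩ := exists_extendedTriangleGroup_hom ![a, c, b]
      (by simp [Fin.forall_fin_succ, ha, hb, hc]) hcb (htop _) hac
    exact ⟨ρ, hρ.trans (congrArg _ (by ext; simp; tauto))⟩
  · refine groupHasCARP_of_hom (x := p) (y := q) (by simpa using hyp)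
      fun Ω a b c ha hb hc hac hcb => ?_
    obtain ⟨ρ, hρ⟩ := exists_extendedTriangleGroup_hom ![b, a, c]
      (by simp [Fin.forall_fin_succ, ha, hb, hc]) hac hcb (htop _)
    exact ⟨ρ, hρ.trans (congrArg _ (by ext; simp; tauto))⟩

theorem corollary6p2 (p q r : ℕ∞) (hyp : IsHyperbolicTriple p q r)
    (hinf : p = ⊤ ∨ q = ⊤ ∨ r = ⊤) :
    GroupHasCARP.{u} (ExtendedTriangleGroup p q r) ∧ HypermapsHaveCARP.{u, v} p q r := by
  have hΓ := groupHasCARP_extendedTriangleGroup.{u} hyp hinf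
  refine ⟨hΓ, fun A _ _ => ?_⟩
  obtain ⟨M, ⟨e⟩⟩ := hΓ A
  obtain ⟨H, hH, ⟨e'⟩⟩ := Hypermap.exists_isConnected_aut_mulEquiv.{v} M
  exact ⟨H, hH, ⟨e.trans e'⟩⟩
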